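/- Let $(M,\rho)$ be an unbounded metric space and $\mu$ a Borel measure on $M$ with $0<\mu(M)<\infty$. A ball $B$ is an open ball with a given centre $c_B$ and radius $r_B>0$, and $2B$ is the ball with the same centre and twice the radius. Assume: (LD) for every $b>0$ there is a constant $D_b$ such that $\mu(2B)\le D_b\,\mu(B)$ for every ball $B$ with $r_B\le b$; (complementary isoperimetric property) there are a ball $B_0$ and constants $\kappa_0,c>0$ such that $$\mu\bigl(\{x\in A:\rho(x,A^c)\le\kappa\}\bigr)\ge c\,\kappa\,\mu(A)$$ for every open set $A\subset M\setminus\overline{B_0}$ and every $\kappa\in(0,\kappa_0]$. For $b'>0$ and $f\in L^1(\mu)$ (complex valued) let $$f^{\sharp,b'}(x)=\sup_{B}\frac1{\mu(B)}\int_B|f-f_B|\,d\mu,\qquad f_B=\frac1{\mu(B)}\int_B f\,d\mu,$$ where the supremum is over all balls $B$ with $r_B\le b'$ and $x\in B$. Then for every scale $b'>0$ and every $p\in(1,\infty)$ there is a constant $C>0$ such that $$\|f\|_{L^1(\mu)}+\|f^{\sharp,b'}\|_{L^p(\mu)}\ \ge\ C\,\|f\|_{L^p(\mu)}\qquad\text{for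 all } f\in L^p(\mu)$$ (the left-hand side may be $+\infty$). -/

import Mathlib

open MeasureTheory Metric Set
open scoped ENNReal

/-- The local doubling property: for every `b > 0` there is a constant `D_b` such that
`μ (2 B) ≤ D_b * μ B` for every (open) ball `B` of radius at most `b`. -/
def LocallyDoubling {M : Type*} [MetricSpace M] [MeasurableSpace M] (μ : Measure M) : Prop :=
  ∀ b : ℝ, 0 < b → ∃ D : ℝ, 0 < D ∧ ∀ (x : M) (r : ℝ), 0 < r → r ≤ b →
    μ (ball x (2 * r)) ≤ ENNReal.ofReal D * μ (ball x r)

/-- The set `A_κ = {x ∈ A : ρ(x, Aᶜ) ≤ κ}` of points of `A` at distance at most `κ` from the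
complement of `A` (the distance to the empty set is `∞`). -/
def innerBoundaryLayer {M : Type*} [MetricSpace M] (A : Set M) (κ : ℝ) : Set M :=
  {x ∈ A | infEDist x Aᶜ ≤ ENNReal.ofReal κ}

/-- The complementary isoperimetric property: there are a ball `B₀` and constants `κ₀, C > 0`
such that `μ (A_κ) ≥ C κ μ A` for every open set `A` contained in the complement of the closure
of `B₀` and every `κ ∈ (0, κ₀]`. -/
def ComplementaryIsoperimetric {M : Type*} [MetricSpace M] [MeasurableSpace M]
    (μ : Measure M) : Prop :=
  ∃ (c₀ : M) (r₀ κ₀ C : ℝ), 0 < r₀ ∧ 0 < κ₀ ∧ 0 < C ∧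
    ∀ A : Set M, IsOpen A → A ⊆ (closure (ball c₀ r₀))ᶜ →
      ∀ κ : ℝ, 0 < κ → κ ≤ κ₀ →
        ENNReal.ofReal (C * κ) * μ A ≤ μ (innerBoundaryLayer A κ)

/-- The local sharp function at scale `b`: the supremum, over all balls `B` of radius at most `b`
that contain `x`, of the mean oscillation `μ(B)⁻¹ ∫_B |f - f_B| dμ`, with values in `[0, ∞]`. -/
noncomputable def localSharp {M : Type*} [MetricSpace M] [MeasurableSpace M] (μ : Measure M)
    (b : ℝ) (f : M → ℂ) (x : M) : ℝ≥0∞ :=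
  ⨆ (c : M) (r : ℝ) (_ : 0 < r ∧ r ≤ b ∧ x ∈ ball c r),
    ⨍⁻ y in ball c r, ‖f y - ⨍ z in ball c r, f z ∂μ‖ₑ ∂μ

/-! This is a local Fefferman–Stein inequality, proved by good-`λ`. Let `A_t` be the set where the
maximal function over balls of radius at most `R = b / 8` exceeds `t`. The usual Whitney argument
bounds the part of `A_{Kt}` where the sharp function is at most `ε t` by a small multiple of `μ
A_t`, but it needs balls of size comparable to the distance to `A_tᶜ`. With balls of bounded radius
it therefore works only in the layer of `A_t` within `κ` of the complement
(`BallsPos.goodLambda_layer`).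

Isoperimetry makes up for the rest: if `μ A_t` is small, the layer carries a fraction `θ` of `μ A_t`
(`ComplementaryIsoperimetric.exists_layer`), so the uncontrolled interior has at most `(1 - θ) μ
A_t`. Hence `μ A_{Kt} ≤ μ {f♯ > ε t} + (1 - θ / 2) μ A_t` (`BallsPos.measure_maxSet_le`). The factor
`1 - θ / 2` is not small, so `K` is taken close to `1` with `K ^ p (1 - θ / 2) < 1`, and the
estimate is summed over the levels `K ^ n t` (`exists_lintegral_rpow_le_of_goodLambda`).

The weak `(1, 1)` bound makes `A_t` small once `t` is at least a fixed multiple of `‖f‖₁`; lower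
levels cost only a multiple of `‖f‖₁ ^ p μ(M)`. -/

open scoped NNReal Topology
open Filter

/-! ### Local doubling and Vitali coverings -/

section Doubling

variable {M : Type*} [MetricSpace M] [MeasurableSpace M] {μ : Measure M}

/-- Doubling with constant `D` for all balls of radius at most `b`. -/
def DoublingUpTo (μ : Measure M) (D : ℝ≥0) (b : ℝ) : Prop :=
  ∀ (x : M) (r : ℝ), 0 < r → r ≤ b → μ (ball x (2 * r)) ≤ D * μ (ball x r)

/-- Every ball has positive measure. -/
def BallsPos (μ : Measure M) : Prop := ∀ (x : M) (r : ℝ), 0 < r → μ (ball x r) ≠ 0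

lemma LocallyDoubling.exists_doublingUpTo (h : LocallyDoubling μ) {b : ℝ} (hb : 0 < b) :
    ∃ D : ℝ≥0, DoublingUpTo μ D b := by
  obtain ⟨D, -, hD⟩ := h b hb
  exact ⟨D.toNNReal, hD⟩

lemma DoublingUpTo.pow {D : ℝ≥0} {b : ℝ} (h : DoublingUpTo μ D b) (x : M) {r : ℝ} (hr : 0 < r)
    (n : ℕ) (hn : 2 ^ n * r ≤ b) : μ (ball x (2 ^ n * r)) ≤ (D : ℝ≥0∞) ^ n * μ (ball x r) := by
  induction n with
  | zero => simp
  | succ n ih =>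
    have h2 : (0 : ℝ) < 2 ^ n * r := by positivity
    have e : (2 : ℝ) ^ (n + 1) * r = 2 * (2 ^ n * r) := by ring
    rw [e] at hn ⊢
    calc μ (ball x (2 * (2 ^ n * r))) ≤ D * μ (ball x (2 ^ n * r)) := h x _ h2 (by linarith)
      _ ≤ D * ((D : ℝ≥0∞) ^ n * μ (ball x r)) := by gcongr; exact ih (by linarith)
      _ = _ := by ring

/-- Doubling holds at every scale, with constants depending on the scale, so one null ball would
make all its dilates null, and these exhaust the space. -/
lemma LocallyDoubling.ballsPos (h : LocallyDoubling μ) (hμ : 0 < μ univ) : BallsPos μ := by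
  intro x r hr h0
  have key : ∀ n : ℕ, μ (ball x (2 ^ n * r)) = 0 := by
    intro n
    obtain ⟨D, hD⟩ := h.exists_doublingUpTo (b := 2 ^ n * r) (by positivity)
    have := hD.pow x hr n le_rfl
    simpa [h0] using this
  have hU : (⋃ n : ℕ, ball x (2 ^ n * r)) = univ := by
    refine eq_univ_of_forall fun y => mem_iUnion.2 ?_
    obtain ⟨n, hn⟩ := pow_unbounded_of_one_lt (dist y x / r) (one_lt_two)
    exact ⟨n, by rw [mem_ball]; rwa [div_lt_iff₀ hr] at hn⟩
  rw [← hU, measure_iUnion_null key] at hμ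
  exact lt_irrefl _ hμ

/-- The superlevel set of the uncentred local maximal function of `g`. -/
def maxSet (μ : Measure M) (R : ℝ) (g : M → ℝ≥0∞) (t : ℝ≥0∞) : Set M :=
  ⋃ q ∈ {q : M × ℝ | (0 < q.2 ∧ q.2 ≤ R) ∧ t * μ (ball q.1 q.2) < ∫⁻ y in ball q.1 q.2, g y ∂μ},
    ball q.1 q.2

lemma mem_maxSet {R : ℝ} {g : M → ℝ≥0∞} {t : ℝ≥0∞} {x : M} : x ∈ maxSet μ R g t ↔
    ∃ c r, 0 < r ∧ r ≤ R ∧ x ∈ ball c r ∧ t * μ (ball c r) < ∫⁻ y in ball c r, g y ∂μ := by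
  simp only [maxSet, mem_iUnion, Prod.exists, mem_ofPred_eq]
  grind

variable [BorelSpace M] [IsFiniteMeasure μ]

/-- The Vitali covering lemma for open balls. -/
lemma BallsPos.vitali (hpos : BallsPos μ) {ι : Type*} (t : Set ι) (x : ι → M) (r : ι → ℝ) (R : ℝ)
    (hr : ∀ a ∈ t, 0 < r a ∧ r a ≤ R) :
    ∃ u ⊆ t, u.Countable ∧ (u.PairwiseDisjoint fun a => ball (x a) (r a)) ∧
      ⋃ a ∈ t, ball (x a) (r a) ⊆ ⋃ a ∈ u, ball (x a) (8 * r a) := by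
  -- Closed balls dilated by `5` fit into open balls dilated by `8 = 2 ^ 3`, which cost three
  -- doublings.
  obtain ⟨u, hut, hdisj, hcov⟩ := Vitali.exists_disjoint_subfamily_covering_enlargement_closedBall
    t x r R (fun a ha => (hr a ha).2) 5 (by norm_num)
  have hd : u.PairwiseDisjoint fun a => ball (x a) (r a) :=
    hdisj.mono_on fun a _ => ball_subset_closedBall
  refine ⟨u, hut, ?_, hd, ?_⟩
  · have := Measure.countable_meas_pos_of_disjoint_iUnion (μ := μ)
      (As := fun a : u => ball (x a) (r a)) (fun a => measurableSet_ball)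
      (fun a b hab => hd a.2 b.2 (fun h => hab (Subtype.ext h)))
    have h2 : {i : u | 0 < μ (ball (x i) (r i))} = univ :=
      eq_univ_of_forall fun i => pos_iff_ne_zero.2 (hpos _ _ (hr _ (hut i.2)).1)
    rw [h2] at this
    exact countable_coe_iff.1 (countable_univ_iff.1 this)
  · refine iUnion₂_subset fun a ha => ?_
    obtain ⟨b, hb, hab⟩ := hcov a ha
    refine (ball_subset_closedBall.trans hab).trans
      ((closedBall_subset_ball ?_).trans (subset_biUnion_of_mem (u := fun a => ball (x a) (8 * r a)) hb))
    have := (hr b (hut hb)).1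
    linarith

/-- A finite measure admits only countably many disjoint balls of positive mass, so Vitali at a
fixed radius yields a countable `ε`-net. Used for Lebesgue differentiation. -/
lemma BallsPos.secondCountableTopology (hpos : BallsPos μ) : SecondCountableTopology M := by
  refine Metric.secondCountable_of_almost_dense_set fun ε hε => ?_
  obtain ⟨u, -, hu, -, hcov⟩ := hpos.vitali univ id (fun _ => ε / 8) (ε / 8)
    (fun a _ => ⟨by positivity, le_rfl⟩)
  refine ⟨u, hu, fun x => ?_⟩
  have hx := hcov (mem_biUnion (mem_univ x) (mem_ball_self (by positivity)))
  obtain ⟨y, hy, hxy⟩ := mem_iUnion₂.1 hx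
  refine ⟨y, hy, ?_⟩
  have := mem_ball.1 hxy
  simp only [id] at this
  linarith

end Doubling

/-! ### The local maximal function and the sharp function -/

section Maximal

variable {M : Type*} [MetricSpace M] [MeasurableSpace M] {μ : Measure M}

lemma isOpen_maxSet (R : ℝ) (g : M → ℝ≥0∞) (t : ℝ≥0∞) : IsOpen (maxSet μ R g t) :=
  isOpen_biUnion fun _ _ => isOpen_ball

lemma maxSet_anti (R : ℝ) (g : M → ℝ≥0∞) {s t : ℝ≥0∞} (h : s ≤ t) :
    maxSet μ R g t ⊆ maxSet μ R g s := by
  intro x hx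
  obtain ⟨c, r, hr, hrR, hxc, hlt⟩ := mem_maxSet.1 hx
  exact mem_maxSet.2 ⟨c, r, hr, hrR, hxc, lt_of_le_of_lt (by gcongr) hlt⟩

lemma setLIntegral_le_of_notMem_maxSet {R : ℝ} {g : M → ℝ≥0∞} {t : ℝ≥0∞} {y c : M} {r : ℝ}
    (hy : y ∉ maxSet μ R g t) (hr : 0 < r) (hrR : r ≤ R) (hyc : y ∈ ball c r) :
    ∫⁻ z in ball c r, g z ∂μ ≤ t * μ (ball c r) := by
  by_contra! h
  exact hy (mem_maxSet.2 ⟨c, r, hr, hrR, hyc, h⟩)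

lemma localSharp_eq (b : ℝ) (f : M → ℂ) (x : M) : localSharp μ b f x =
    ⨆ (c : M) (r : ℝ) (_ : 0 < r ∧ r ≤ b ∧ x ∈ ball c r),
      (∫⁻ y in ball c r, ‖f y - ⨍ z in ball c r, f z ∂μ‖ₑ ∂μ) / μ (ball c r) := by
  simp only [localSharp, setLAverage_eq]

lemma BallsPos.lintegral_oscillation_le [IsFiniteMeasure μ] (hpos : BallsPos μ) {b : ℝ} {f : M → ℂ} {x c : M} {r : ℝ}
    {s : ℝ≥0∞} (hs : localSharp μ b f x ≤ s) (hr : 0 < r) (hrb : r ≤ b) (hx : x ∈ ball c r) :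
    ∫⁻ y in ball c r, ‖f y - ⨍ z in ball c r, f z ∂μ‖ₑ ∂μ ≤ s * μ (ball c r) := by
  rw [localSharp_eq] at hs
  simp only [iSup_le_iff] at hs
  exact (ENNReal.div_le_iff (hpos c r hr) (measure_ne_top _ _)).1 (hs c r ⟨hr, hrb, hx⟩)

lemma DoublingUpTo.isUnifLocDoublingMeasure {D : ℝ≥0} {b : ℝ} (hD : DoublingUpTo μ D b)
    (hb : 0 < b) : IsUnifLocDoublingMeasure μ := by
  refine ⟨D ^ 2, ?_⟩
  have : ∀ᶠ ε in 𝓝[>] (0 : ℝ), ε ∈ Ioo 0 (b / 4) := Ioo_mem_nhdsGT (by positivity)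
  filter_upwards [this] with ε hε x
  calc μ (closedBall x (2 * ε)) ≤ μ (ball x (2 ^ 2 * ε)) :=
        measure_mono (closedBall_subset_ball (by linarith [hε.1]))
    _ ≤ (D : ℝ≥0∞) ^ 2 * μ (ball x ε) := hD.pow x hε.1 2 (by linarith [hε.2])
    _ ≤ _ := by push_cast; gcongr; exact ball_subset_closedBall

variable [BorelSpace M]

/-- The balls are open and uncentred: a ball that witnesses a large oscillation at `x` does so at
all nearby points, so the function is lower semicontinuous. -/
lemma measurable_localSharp (b : ℝ) (f : M → ℂ) : Measurable (localSharp μ b f) := by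
  refine LowerSemicontinuous.measurable fun x t ht => ?_
  simp only [localSharp, lt_iSup_iff] at ht
  obtain ⟨c, r, ⟨hr, hrb, hx⟩, hlt⟩ := ht
  filter_upwards [isOpen_ball.mem_nhds hx] with y hy
  simp only [localSharp, lt_iSup_iff]
  exact ⟨c, r, ⟨hr, hrb, hy⟩, hlt⟩

variable [IsFiniteMeasure μ]

/-- The weak type `(1, 1)` inequality for the local maximal function. -/
lemma BallsPos.mul_measure_maxSet_le (hpos : BallsPos μ) {D : ℝ≥0} {b R : ℝ}
    (hD : DoublingUpTo μ D b) (hR : 8 * R ≤ b) (g : M → ℝ≥0∞) (t : ℝ≥0∞) :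
    t * μ (maxSet μ R g t) ≤ (D : ℝ≥0∞) ^ 3 * ∫⁻ y, g y ∂μ := by
  obtain ⟨u, hut, hu, hdisj, hcov⟩ := hpos.vitali
    {q : M × ℝ | (0 < q.2 ∧ q.2 ≤ R) ∧ t * μ (ball q.1 q.2) < ∫⁻ y in ball q.1 q.2, g y ∂μ}
    Prod.fst Prod.snd R (fun a ha => ha.1)
  have := hu.to_subtype
  calc t * μ (maxSet μ R g t) ≤ t * ∑' a : u, μ (ball a.1.1 (8 * a.1.2)) := by
        gcongr
        refine (measure_mono hcov).trans ?_
        rw [biUnion_eq_iUnion]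
        exact measure_iUnion_le _
    _ ≤ t * ∑' a : u, (D : ℝ≥0∞) ^ 3 * μ (ball a.1.1 a.1.2) := by
        gcongr with a
        have ha := (hut a.2).1
        have := hD.pow a.1.1 ha.1 3 (by linarith [ha.2])
        norm_num at this ⊢
        exact this
    _ = (D : ℝ≥0∞) ^ 3 * ∑' a : u, t * μ (ball a.1.1 a.1.2) := by
        rw [ENNReal.tsum_mul_left, ENNReal.tsum_mul_left]; ring
    _ ≤ (D : ℝ≥0∞) ^ 3 * ∑' a : u, ∫⁻ y in ball a.1.1 a.1.2, g y ∂μ := by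
        gcongr with a
        exact (hut a.2).2.le
    _ = (D : ℝ≥0∞) ^ 3 * ∫⁻ y in ⋃ a : u, ball a.1.1 a.1.2, g y ∂μ := by
        rw [lintegral_iUnion (fun _ => measurableSet_ball)
          (fun (a b : u) hab => hdisj a.2 b.2 (fun h => hab (Subtype.ext h)))]
    _ ≤ _ := by gcongr; exact Measure.restrict_le_self

/-- A function is pointwise dominated by its maximal function, almost everywhere. -/
lemma BallsPos.ae_mem_maxSet (hpos : BallsPos μ) {D : ℝ≥0} {b R : ℝ} (hD : DoublingUpTo μ D b)
    (hb : 0 < b) (hR : 0 < R) {f : M → ℂ} (hf : Integrable f μ) :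
    ∀ᵐ x ∂μ, ∀ t : ℝ≥0∞, t < ‖f x‖ₑ → x ∈ maxSet μ R (fun y => ‖f y‖ₑ) t := by
  have := hpos.secondCountableTopology
  have := hD.isUnifLocDoublingMeasure hb
  filter_upwards [IsUnifLocDoublingMeasure.ae_tendsto_average μ
    hf.norm.locallyIntegrable 1] with x hx t ht
  have h1 := hx (fun _ : ℝ => x) id tendsto_id (by
    filter_upwards [self_mem_nhdsWithin] with r hr
    exact mem_closedBall_self (by simpa using (mem_Ioi.1 hr).le))
  have ht' : t ≠ ∞ := ht.ne_top
  lift t to ℝ≥0 using ht'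
  have h2 : (t : ℝ) < ‖f x‖ := by
    rw [← ofReal_norm, ← ENNReal.ofReal_coe_nnreal, ENNReal.ofReal_lt_ofReal_iff'] at ht
    exact ht.1
  have h3 : ∀ᶠ r in 𝓝[>] (0 : ℝ), r ∈ Ioo 0 R := Ioo_mem_nhdsGT hR
  obtain ⟨r, hr, hr0, hrR⟩ := ((h1.eventually_const_lt h2).and h3).exists
  simp only [id] at hr
  have hcb : μ (closedBall x r) ≠ 0 := fun h =>
    hpos x r hr0 (measure_mono_null ball_subset_closedBall h)
  have h4 : (t : ℝ≥0∞) * μ (closedBall x r) < ∫⁻ y in closedBall x r, ‖f y‖ₑ ∂μ := by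
    have hcb' : 0 < μ.real (closedBall x r) := ENNReal.toReal_pos hcb (measure_ne_top _ _)
    rw [setAverage_eq, smul_eq_mul, ← div_eq_inv_mul, lt_div_iff₀ hcb'] at hr
    rw [← ofReal_integral_norm_eq_lintegral_enorm hf.integrableOn,
      ← ENNReal.ofReal_toReal (measure_ne_top μ (closedBall x r)), ← ENNReal.ofReal_coe_nnreal,
      ← ENNReal.ofReal_mul t.coe_nonneg]
    exact (ENNReal.ofReal_lt_ofReal_iff_of_nonneg (by positivity)).2 hr
  -- Differentiation uses closed balls, the maximal function open ones; the strict inequality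
  -- survives a slight enlargement of the radius.
  have h5 : Tendsto (fun s => (t : ℝ≥0∞) * μ (ball x s)) (𝓝[>] r)
      (𝓝 (t * μ (closedBall x r))) := by
    refine ENNReal.Tendsto.const_mul ?_ (Or.inr ENNReal.coe_ne_top)
    have hI : closedBall x r = ⋂ s > r, ball x s := by
      ext y
      simp only [mem_closedBall, mem_iInter, mem_ball]
      exact ⟨fun h s hs => h.trans_lt hs, fun h => le_of_forall_gt h⟩
    rw [hI]
    exact tendsto_measure_biInter_gt (fun s _ => measurableSet_ball.nullMeasurableSet)
      (fun i j _ hij => ball_subset_ball hij) ⟨r + 1, by simp, measure_ne_top _ _⟩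
  have h6 : ∀ᶠ s in 𝓝[>] r, s ∈ Ioo r R := Ioo_mem_nhdsGT hrR
  obtain ⟨s, hs, hsr, hsR⟩ := ((h5.eventually_lt_const h4).and h6).exists
  refine mem_maxSet.2 ⟨x, s, hr0.trans hsr, hsR.le, mem_ball_self (hr0.trans hsr),
    hs.trans_le ?_⟩
  exact lintegral_mono_set (closedBall_subset_ball hsr)

end Maximal

section Averages

variable {M : Type*} [MeasurableSpace M] {μ : Measure M}

lemma setLIntegral_enorm_le_add (f : M → ℂ) (a : ℂ) (B : Set M) :
    ∫⁻ y in B, ‖f y‖ₑ ∂μ ≤ ‖a‖ₑ * μ B + ∫⁻ y in B, ‖f y - a‖ₑ ∂μ := by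
  rw [← setLIntegral_const, ← lintegral_add_left measurable_const]
  refine lintegral_mono fun y => ?_
  simpa using enorm_add_le a (f y - a)

lemma enorm_mul_measure_le_add {f : M → ℂ} (hf : AEStronglyMeasurable f μ) (a : ℂ) (B : Set M) :
    ‖a‖ₑ * μ B ≤ ∫⁻ y in B, ‖f y‖ₑ ∂μ + ∫⁻ y in B, ‖f y - a‖ₑ ∂μ := by
  rw [← setLIntegral_const, ← lintegral_add_left' hf.enorm.restrict]
  refine lintegral_mono fun y => ?_
  simpa using enorm_sub_le (a := f y) (b := f y - a)

end Averages

/-! ### Good-`λ` estimates near the boundary of a superlevel set -/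

section GoodLambda

variable {M : Type*} [MetricSpace M] [MeasurableSpace M] {μ : Measure M}

variable [BorelSpace M] [IsFiniteMeasure μ]

/-- The good-`λ` inequality on a Whitney ball of the superlevel set of the maximal function. -/
lemma BallsPos.goodLambda_ball (hpos : BallsPos μ) {D : ℝ≥0} {b b' R : ℝ}
    (hD : DoublingUpTo μ D b') (hR : 8 * R ≤ b) (hR' : 16 * R ≤ b') {f : M → ℂ}
    (hf : AEStronglyMeasurable f μ) {t : ℝ≥0∞} (ht0 : t ≠ 0) (ht : t ≠ ∞) {ε δ : ℝ≥0}
    (hεD : (D ^ 3 + D ^ 4) * ε ≤ 2 * δ) (hε : ε ≤ δ) {x y : M} {d : ℝ} (hd : 0 < d)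
    (hdR : 2 * d ≤ R) (hy : y ∉ maxSet μ R (fun z => ‖f z‖ₑ) t) (hyx : dist y x < 2 * d) :
    δ * μ ({z ∈ maxSet μ R (fun z => ‖f z‖ₑ) ((1 + 2 * δ) * t) | localSharp μ b f z ≤ ε * t} ∩
      ball x (d / 2)) ≤ D ^ 8 * ε * μ (ball x (d / 16)) := by
  -- If the set is nonempty, one of its points `z` lies in `B = ball x (2 * d)` and bounds the
  -- oscillation over `B` by `ε t`.
  rcases eq_empty_or_nonempty
    ({z ∈ maxSet μ R (fun z => ‖f z‖ₑ) ((1 + 2 * δ) * t) | localSharp μ b f z ≤ ε * t} ∩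
      ball x (d / 2)) with h0 | ⟨z, ⟨-, hz⟩, hzx⟩
  · simp [h0]
  set B := ball x (2 * d) with hB
  set a := ⨍ z in B, f z ∂μ with ha
  set w : M → ℝ≥0∞ := B.indicator fun z => ‖f z - a‖ₑ with hw
  have hosc : ∫⁻ z in B, ‖f z - a‖ₑ ∂μ ≤ ε * t * μ B :=
    hpos.lintegral_oscillation_le hz (by positivity) (by linarith)
      (ball_subset_ball (by linarith) hzx)
  have ha1 : ‖a‖ₑ ≤ (1 + ε) * t := by
    have h1 := enorm_mul_measure_le_add hf a B
    have h2 := setLIntegral_le_of_notMem_maxSet hy (by positivity) hdR (mem_ball.2 hyx)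
    have h3 : ‖a‖ₑ * μ B ≤ (1 + ε) * t * μ B :=
      h1.trans ((add_le_add h2 hosc).trans_eq (by ring))
    exact (ENNReal.mul_le_mul_iff_left (hpos _ _ (by positivity)) (measure_ne_top _ _)).1 h3
  have hsub : {z ∈ maxSet μ R (fun z => ‖f z‖ₑ) ((1 + 2 * δ) * t) | localSharp μ b f z ≤ ε * t} ∩
      ball x (d / 2) ⊆ maxSet μ R w (δ * t) := by
    rintro v ⟨⟨hv, hvs⟩, hvx⟩
    obtain ⟨c, s, hs, hsR, hvc, hlt⟩ := mem_maxSet.1 hv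
    rw [mem_ball] at hvx hvc
    -- A small witness ball lies in `B`, where the excess over `‖a‖ₑ` must come from `w`. A large
    -- one cannot occur: its dilate by `8` contains `ball y s`, where the mean of `‖f‖ₑ` is at most
    -- `t` because `y` is outside the superlevel set.
    rcases le_or_gt s (d / 2) with hsd | hsd
    · refine mem_maxSet.2 ⟨c, s, hs, hsR, hvc, ?_⟩
      have hcB : ball c s ⊆ B := by
        refine ball_subset_ball' ?_
        have := dist_triangle c v x
        rw [dist_comm c v] at this
        linarith
      have hwe : ∫⁻ z in ball c s, w z ∂μ = ∫⁻ z in ball c s, ‖f z - a‖ₑ ∂μ :=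
        setLIntegral_congr_fun measurableSet_ball fun z hz => indicator_of_mem (hcB hz) _
      rw [hwe]
      by_contra! hle
      refine hlt.not_ge ?_
      calc ∫⁻ z in ball c s, ‖f z‖ₑ ∂μ
          ≤ ‖a‖ₑ * μ (ball c s) + ∫⁻ z in ball c s, ‖f z - a‖ₑ ∂μ :=
            setLIntegral_enorm_le_add f a _
        _ ≤ (1 + ε) * t * μ (ball c s) + δ * t * μ (ball c s) := by gcongr
        _ ≤ (1 + δ) * t * μ (ball c s) + δ * t * μ (ball c s) := by gcongr
        _ = (1 + 2 * δ) * t * μ (ball c s) := by ring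
    · exfalso
      set a' := ⨍ z in ball c (8 * s), f z ∂μ with ha'
      have hyc : dist y c ≤ 6 * s := by
        have h1 := dist_triangle y x c
        have h2 := dist_triangle x v c
        rw [dist_comm x v] at h2
        linarith
      have hosc' : ∫⁻ z in ball c (8 * s), ‖f z - a'‖ₑ ∂μ ≤ ε * t * μ (ball c (8 * s)) :=
        hpos.lintegral_oscillation_le hvs (by positivity) (by linarith)
          (mem_ball.2 (by linarith))
      have hm1 : μ (ball c (8 * s)) ≤ D ^ 3 * μ (ball c s) := by
        have := hD.pow c hs 3 (by linarith)
        norm_num at this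
        exact this
      have hm2 : μ (ball c (8 * s)) ≤ D ^ 4 * μ (ball y s) := by
        have := hD.pow y hs 4 (by linarith)
        norm_num at this
        refine (measure_mono (ball_subset_ball' ?_)).trans this
        rw [dist_comm]
        linarith
      have h1 : ‖a'‖ₑ * μ (ball y s) ≤ (t + ε * t * D ^ 4) * μ (ball y s) := by
        calc ‖a'‖ₑ * μ (ball y s)
            ≤ ∫⁻ z in ball y s, ‖f z‖ₑ ∂μ + ∫⁻ z in ball y s, ‖f z - a'‖ₑ ∂μ :=
              enorm_mul_measure_le_add hf a' _
          _ ≤ t * μ (ball y s) + ∫⁻ z in ball c (8 * s), ‖f z - a'‖ₑ ∂μ := by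
              gcongr
              · exact setLIntegral_le_of_notMem_maxSet hy hs hsR (mem_ball_self hs)
              · exact ball_subset_ball' (by linarith)
          _ ≤ t * μ (ball y s) + ε * t * (D ^ 4 * μ (ball y s)) := by
              gcongr
              exact hosc'.trans (by gcongr)
          _ = _ := by ring
      have h1' := (ENNReal.mul_le_mul_iff_left (hpos _ _ hs) (measure_ne_top _ _)).1 h1
      refine hlt.not_ge ?_
      calc ∫⁻ z in ball c s, ‖f z‖ₑ ∂μ
          ≤ ‖a'‖ₑ * μ (ball c s) + ∫⁻ z in ball c s, ‖f z - a'‖ₑ ∂μ :=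
            setLIntegral_enorm_le_add f a' _
        _ ≤ (t + ε * t * D ^ 4) * μ (ball c s) + ∫⁻ z in ball c (8 * s), ‖f z - a'‖ₑ ∂μ := by
            gcongr
            linarith
        _ ≤ (t + ε * t * D ^ 4) * μ (ball c s) + ε * t * (D ^ 3 * μ (ball c s)) := by
            gcongr
            exact hosc'.trans (by gcongr)
        _ = (1 + ((D ^ 3 + D ^ 4) * ε : ℝ≥0)) * t * μ (ball c s) := by push_cast; ring
        _ ≤ (1 + (2 * δ : ℝ≥0)) * t * μ (ball c s) := by gcongr
        _ = _ := by push_cast; ring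
  -- The factor `D ^ 8` is `D ^ 3` from the weak type bound times `D ^ 5` from comparing radii `2 *
  -- d` and `d / 16`.
  have hweak := hpos.mul_measure_maxSet_le hD (R := R) (by linarith) w (δ * t)
  have hBm : μ B ≤ D ^ 5 * μ (ball x (d / 16)) := by
    have := hD.pow x (r := d / 16) (by positivity) 5 (by linarith)
    rwa [show (2 : ℝ) ^ 5 * (d / 16) = 2 * d by ring] at this
  have hfin : t * (δ * μ (maxSet μ R w (δ * t))) ≤ t * (D ^ 8 * ε * μ (ball x (d / 16))) := by
    calc t * (δ * μ (maxSet μ R w (δ * t))) = δ * t * μ (maxSet μ R w (δ * t)) := by ring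
      _ ≤ D ^ 3 * ∫⁻ z, w z ∂μ := hweak
      _ = D ^ 3 * ∫⁻ z in B, ‖f z - a‖ₑ ∂μ := by rw [hw, lintegral_indicator measurableSet_ball]
      _ ≤ D ^ 3 * (ε * t * (D ^ 5 * μ (ball x (d / 16)))) := by
          gcongr
          exact hosc.trans (by gcongr)
      _ = _ := by ring
  refine le_trans (by gcongr) ((ENNReal.mul_le_mul_iff_right ht0 ht).1 hfin)

/-- The good-`λ` inequality on the boundary layer of the superlevel set. -/
lemma BallsPos.goodLambda_layer (hpos : BallsPos μ) {D : ℝ≥0} {b b' R : ℝ}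
    (hD : DoublingUpTo μ D b') (hR : 8 * R ≤ b) (hR' : 16 * R ≤ b') {f : M → ℂ}
    (hf : AEStronglyMeasurable f μ) {t : ℝ≥0∞} (ht0 : t ≠ 0) (ht : t ≠ ∞) {ε δ : ℝ≥0}
    (hεD : (D ^ 3 + D ^ 4) * ε ≤ 2 * δ) (hε : ε ≤ δ) {κ : ℝ} (hκ0 : 0 ≤ κ) (hκ : 2 * κ ≤ R) :
    δ * μ ({z ∈ maxSet μ R (fun z => ‖f z‖ₑ) ((1 + 2 * δ) * t) | localSharp μ b f z ≤ ε * t} ∩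
      innerBoundaryLayer (maxSet μ R (fun z => ‖f z‖ₑ) t) κ) ≤
      D ^ 8 * ε * μ (maxSet μ R (fun z => ‖f z‖ₑ) t) := by
  set A := maxSet μ R (fun z => ‖f z‖ₑ) t with hA
  set E := {z ∈ maxSet μ R (fun z => ‖f z‖ₑ) ((1 + 2 * δ) * t) | localSharp μ b f z ≤ ε * t}
  set ρ : M → ℝ := fun x => (infEDist x Aᶜ).toReal with hρ
  have hfin : ∀ x ∈ innerBoundaryLayer A κ, infEDist x Aᶜ = ENNReal.ofReal (ρ x) := fun x hx =>
    (ENNReal.ofReal_toReal (ne_top_of_le_ne_top ENNReal.ofReal_ne_top hx.2)).symm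
  have hρ0 : ∀ x ∈ innerBoundaryLayer A κ, 0 < ρ x ∧ ρ x ≤ κ := fun x hx => by
    have h1 : infEDist x Aᶜ ≠ 0 := by
      rw [← pos_iff_ne_zero, infEDist_pos_iff_notMem_closure,
        (isOpen_maxSet R _ t).isClosed_compl.closure_eq]
      exact fun h => h hx.1
    refine ⟨ENNReal.toReal_pos h1 (ne_top_of_le_ne_top ENNReal.ofReal_ne_top hx.2), ?_⟩
    exact ENNReal.toReal_le_of_le_ofReal hκ0 hx.2
  -- Whitney balls: the disjoint balls of radius `ρ x / 16` stay inside `A`, and their dilates of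
  -- radius `ρ x / 2` cover the layer.
  obtain ⟨u, hut, hu, hdisj, hcov⟩ := hpos.vitali (innerBoundaryLayer A κ) id
    (fun x => ρ x / 16) (κ / 16)
    (fun x hx => ⟨by linarith [hρ0 x hx], by linarith [hρ0 x hx]⟩)
  simp only [id] at hdisj hcov
  have := hu.to_subtype
  have hball : ∀ x ∈ innerBoundaryLayer A κ, ball x (ρ x / 16) ⊆ A := fun x hx y hy => by
    by_contra hyA
    have h1 : infEDist x Aᶜ ≤ edist x y := infEDist_le_edist_of_mem hyA
    rw [hfin x hx, edist_dist, dist_comm] at h1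
    have h2 := (ENNReal.ofReal_le_ofReal_iff dist_nonneg).1 h1
    linarith [mem_ball.1 hy, hρ0 x hx]
  have hone : ∀ x ∈ innerBoundaryLayer A κ,
      δ * μ (E ∩ ball x (ρ x / 2)) ≤ D ^ 8 * ε * μ (ball x (ρ x / 16)) := fun x hx => by
    obtain ⟨h1, h2⟩ := hρ0 x hx
    -- The distance need not be attained; the factor `2` provides an actual point of `Aᶜ`.
    have h3 : infEDist x Aᶜ < ENNReal.ofReal (2 * ρ x) := by
      rw [hfin x hx]
      exact (ENNReal.ofReal_lt_ofReal_iff (by positivity)).2 (by linarith)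
    obtain ⟨y, hy, hxy⟩ := infEDist_lt_iff.1 h3
    refine hpos.goodLambda_ball hD hR hR' hf ht0 ht hεD hε h1 (by linarith) hy ?_
    rw [dist_comm]
    exact edist_lt_ofReal.1 hxy
  have hcov' : E ∩ innerBoundaryLayer A κ ⊆ ⋃ x : u, E ∩ ball x.1 (ρ x / 2) := by
    rintro z ⟨hzE, hz⟩
    obtain ⟨x, hx, hzx⟩ := mem_iUnion₂.1
      (hcov (mem_biUnion hz (mem_ball_self (by linarith [hρ0 z hz]))))
    refine mem_iUnion.2 ⟨⟨x, hx⟩, hzE, ?_⟩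
    rwa [show 8 * (ρ x / 16) = ρ x / 2 by ring] at hzx
  calc δ * μ (E ∩ innerBoundaryLayer A κ) ≤ δ * ∑' x : u, μ (E ∩ ball x.1 (ρ x / 2)) := by
        gcongr
        exact (measure_mono hcov').trans (measure_iUnion_le _)
    _ = ∑' x : u, δ * μ (E ∩ ball x.1 (ρ x / 2)) := ENNReal.tsum_mul_left.symm
    _ ≤ ∑' x : u, D ^ 8 * ε * μ (ball x.1 (ρ x / 16)) :=
        ENNReal.tsum_le_tsum fun x => hone x (hut x.2)
    _ = D ^ 8 * ε * μ (⋃ x : u, ball x.1 (ρ x / 16)) := by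
        rw [ENNReal.tsum_mul_left, measure_iUnion (f := fun x : u => ball x.1 (ρ x / 16))
          (fun (x y : u) hxy => hdisj x.2 y.2 (fun h => hxy (Subtype.ext h)))
          (fun _ => measurableSet_ball)]
    _ ≤ D ^ 8 * ε * μ A := by
        gcongr
        exact iUnion_subset fun x => hball x (hut x.2)

end GoodLambda

/-! ### Summation over geometric levels -/

section Summation

/-- A geometric sum is controlled by its last term. The bound by `a N` carries the induction; the
bound by `(1 + q) * U` is the one applied. -/
lemma mul_sum_ite_lt_le {a : ℕ → ℝ≥0∞} {q U : ℝ≥0∞} (ha : ∀ n, a (n + 1) = (1 + q) * a n)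
    (N : ℕ) : q * ∑ n ∈ Finset.range N, (if a n < U then a n else 0) ≤
      min (a N) ((1 + q) * U) := by
  induction N with
  | zero => simp
  | succ N ih =>
    rw [Finset.sum_range_succ, mul_add]
    obtain ⟨ih1, ih2⟩ := le_min_iff.1 ih
    split_ifs with h
    · have h1 : q * ∑ n ∈ Finset.range N, (if a n < U then a n else 0) + q * a N ≤ a (N + 1) := by
        rw [ha, add_mul, one_mul]
        gcongr
      refine le_min h1 (h1.trans ?_)
      rw [ha]
      gcongr
    · rw [mul_zero, add_zero]
      refine le_min (ih1.trans ?_) ih2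
      rw [ha]
      exact le_mul_of_one_le_left' le_self_add

variable {M : Type*} [MeasurableSpace M]

/-- A distributional inequality along a geometric sequence of levels implies an `L^p` bound. -/
lemma exists_lintegral_rpow_le_of_goodLambda {p : ℝ} (hp : 0 < p) {K α ε : ℝ≥0} (hK : 1 < K)
    (hα : K ^ p * α < 1) (hε : ε ≠ 0) : ∃ C : ℝ≥0, ∀ (μ : Measure M) [IsFiniteMeasure μ]
      (g h : M → ℝ≥0∞) (A : ℕ → Set M) (t : ℝ≥0∞), Measurable h → (∀ x, g x ≠ ∞) → t ≠ 0 → t ≠ ∞ →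
      (∀ n, MeasurableSet (A n)) → (∀ᵐ x ∂μ, ∀ n, K ^ n * t < g x → x ∈ A n) →
      (∀ n, μ (A (n + 1)) ≤ μ {x | ε * (K ^ n * t) < h x} + α * μ (A n)) →
      ∫⁻ x, g x ^ p ∂μ ≤ C * (t ^ p * μ univ + ∫⁻ x, h x ^ p ∂μ) := by
  set Q : ℝ≥0 := K ^ p with hQ
  have hQ1 : 1 < Q := NNReal.one_lt_rpow hK hp
  obtain ⟨q, hq⟩ : ∃ q, Q = 1 + q := exists_add_of_le hQ1.le
  have hq0 : q ≠ 0 := by rintro rfl; simp [hq] at hQ1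
  obtain ⟨β, hβ⟩ : ∃ β, Q * α + β = 1 := (exists_add_of_le hα.le).imp fun _ h => h.symm
  have hβ0 : β ≠ 0 := by rintro rfl; rw [add_zero] at hβ; exact hα.ne hβ
  have hεp : ε ^ p ≠ 0 := by simp [NNReal.rpow_eq_zero_iff, hε]
  refine ⟨1 + Q * (β⁻¹ * (1 + Q * ((q * ε ^ p)⁻¹ * Q))), ?_⟩
  intro μ _ g h A t hh hg ht0 ht hA hgA hrec
  set a : ℕ → ℝ≥0∞ := fun n => (K ^ n * t) ^ p with ha
  have hasucc : ∀ n, a (n + 1) = Q * a n := fun n => by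
    simp only [ha, pow_succ']
    rw [mul_assoc, ENNReal.mul_rpow_of_nonneg _ _ hp.le, hQ, ENNReal.coe_rpow_of_nonneg _ hp.le]
  have ha_top : ∀ n, a n ≠ ∞ := fun n =>
    ENNReal.rpow_ne_top_of_nonneg hp.le (ENNReal.mul_ne_top (by simp) ht)
  set X := t ^ p * μ univ with hX
  set Y := ∫⁻ x, h x ^ p ∂μ with hY
  -- the contribution of `h`
  have hψ : ∀ N, ∑ n ∈ Finset.range N, a n * μ {x | ε * (K ^ n * t) < h x} ≤
      ((q * ε ^ p)⁻¹ * Q : ℝ≥0) * Y := by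
    intro N
    have hm : ∀ n, MeasurableSet {x | ε * (K ^ n * t) < h x} := fun n =>
      measurableSet_lt measurable_const hh
    have h1 : ((q * ε ^ p : ℝ≥0) : ℝ≥0∞) *
        ∑ n ∈ Finset.range N, a n * μ {x | ε * (K ^ n * t) < h x} ≤ Q * Y := by
      calc ((q * ε ^ p : ℝ≥0) : ℝ≥0∞) * ∑ n ∈ Finset.range N, a n * μ {x | ε * (K ^ n * t) < h x}
          = q * ∑ n ∈ Finset.range N, ∫⁻ x, {x | ε * (K ^ n * t) < h x}.indicator
              (fun _ => (ε * (K ^ n * t)) ^ p) x ∂μ := by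
            rw [ENNReal.coe_mul, mul_assoc, Finset.mul_sum]
            congr 1
            refine Finset.sum_congr rfl fun n _ => ?_
            rw [lintegral_indicator_const (hm n), ENNReal.mul_rpow_of_nonneg _ _ hp.le,
              ENNReal.coe_rpow_of_nonneg _ hp.le, mul_assoc]
        _ = ∫⁻ x, q * ∑ n ∈ Finset.range N, {x | ε * (K ^ n * t) < h x}.indicator
              (fun _ => (ε * (K ^ n * t)) ^ p) x ∂μ := by
            rw [lintegral_const_mul _ (Finset.measurable_fun_sum _ fun n _ =>
              measurable_const.indicator (hm n)), lintegral_finsetSum _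
              fun n _ => measurable_const.indicator (hm n)]
        _ ≤ ∫⁻ x, Q * h x ^ p ∂μ := by
            refine lintegral_mono fun x => ?_
            have := mul_sum_ite_lt_le (a := fun n => (ε * (K ^ n * t)) ^ p) (q := q)
              (U := h x ^ p) (fun n => by
                rw [← ENNReal.coe_one, ← ENNReal.coe_add, ← hq, hQ,
                  ENNReal.coe_rpow_of_nonneg _ hp.le, ← ENNReal.mul_rpow_of_nonneg _ _ hp.le]
                congr 1
                ring) N
            rw [← ENNReal.coe_one, ← ENNReal.coe_add, ← hq] at this
            refine le_trans ?_ (this.trans (min_le_right _ _))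
            gcongr with n
            simp only [indicator_apply, mem_ofPred_eq, ENNReal.rpow_lt_rpow_iff hp]
            exact le_rfl
        _ = Q * Y := lintegral_const_mul _ (hh.pow_const p)
    have hne : q * ε ^ p ≠ 0 := mul_ne_zero hq0 hεp
    rw [ENNReal.coe_mul, ENNReal.coe_inv hne, mul_assoc, mul_comm, ← div_eq_mul_inv,
      ENNReal.le_div_iff_mul_le (Or.inl (by simpa using hne)) (Or.inl ENNReal.coe_ne_top), mul_comm]
    exact h1
  -- the sum over the levels
  have hS : ∀ N, ∑ n ∈ Finset.range N, a n * μ (A n) ≤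
      (β⁻¹ * (1 + Q * ((q * ε ^ p)⁻¹ * Q)) : ℝ≥0) * (X + Y) := by
    intro N
    set S := ∑ n ∈ Finset.range N, a n * μ (A n) with hSdef
    -- Partial sums are finite because `μ` is, so `(Q * α) * S` can be absorbed on the left, leaving
    -- `β * S`; the resulting bound does not depend on `N`.
    have hStop : S ≠ ∞ := by
      rw [hSdef, ENNReal.sum_ne_top]
      exact fun n _ => ENNReal.mul_ne_top (ha_top n) (measure_ne_top _ _)
    have h1 : S ≤ (1 + Q * ((q * ε ^ p)⁻¹ * Q) : ℝ≥0) * (X + Y) + (Q * α : ℝ≥0) * S := by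
      calc S ≤ ∑ n ∈ Finset.range (N + 1), a n * μ (A n) :=
            Finset.sum_le_sum_of_subset (Finset.range_mono N.le_succ)
        _ = ∑ n ∈ Finset.range N, a (n + 1) * μ (A (n + 1)) + a 0 * μ (A 0) :=
            Finset.sum_range_succ' _ _
        _ ≤ ∑ n ∈ Finset.range N,
              Q * a n * (μ {x | ε * (K ^ n * t) < h x} + α * μ (A n)) + X := by
            gcongr with n
            · exact (hasucc n).le
            · exact hrec n
            · simp only [ha, hX, pow_zero, one_mul]
              gcongr
              exact subset_univ _
        _ = Q * ∑ n ∈ Finset.range N, a n * μ {x | ε * (K ^ n * t) < h x} + X +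
              (Q * α : ℝ≥0) * S := by
            rw [hSdef, Finset.mul_sum, Finset.mul_sum, add_right_comm, ← Finset.sum_add_distrib]
            congr 1
            refine Finset.sum_congr rfl fun n _ => ?_
            push_cast
            ring
        _ ≤ Q * (((q * ε ^ p)⁻¹ * Q : ℝ≥0) * Y) + X + (Q * α : ℝ≥0) * S := by
            gcongr
            exact hψ N
        _ ≤ Q * (((q * ε ^ p)⁻¹ * Q : ℝ≥0) * (X + Y)) + (X + Y) + (Q * α : ℝ≥0) * S := by
            gcongr
            · exact le_add_self
            · exact le_self_add
        _ = _ := by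
            generalize (q * ε ^ p)⁻¹ * Q = c
            push_cast
            ring
    have h2 : (Q * α : ℝ≥0) * S + β * S ≤
        (Q * α : ℝ≥0) * S + (1 + Q * ((q * ε ^ p)⁻¹ * Q) : ℝ≥0) * (X + Y) := by
      rw [← add_mul, ← ENNReal.coe_add, hβ, ENNReal.coe_one, one_mul, add_comm]
      exact h1
    have h3 := (ENNReal.add_le_add_iff_left (ENNReal.mul_ne_top ENNReal.coe_ne_top hStop)).1 h2
    rw [ENNReal.coe_mul, ENNReal.coe_inv hβ0, mul_assoc, mul_comm, ← div_eq_mul_inv,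
      ENNReal.le_div_iff_mul_le (Or.inl (by simpa using hβ0)) (Or.inl ENNReal.coe_ne_top), mul_comm]
    exact h3
  have hStsum : ∑' n, a n * μ (A n) ≤ (β⁻¹ * (1 + Q * ((q * ε ^ p)⁻¹ * Q)) : ℝ≥0) * (X + Y) := by
    rw [ENNReal.tsum_eq_iSup_nat]
    exact iSup_le hS
  -- When `t < g x`, the single term with `K ^ n * t < g x ≤ K ^ (n + 1) * t` is enough.
  have hpt : ∀ᵐ x ∂μ, g x ^ p ≤ t ^ p + ∑' n, (A n).indicator (fun _ => Q * a n) x := by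
    filter_upwards [hgA] with x hx
    rcases le_or_gt (g x) t with hgt | hgt
    · exact (ENNReal.rpow_le_rpow hgt hp.le).trans le_self_add
    have hex : ∃ n, g x ≤ K ^ n * t := by
      have h1 : Tendsto (fun n : ℕ => (K : ℝ≥0∞) ^ n * t) atTop (𝓝 ∞) := by
        have := ENNReal.Tendsto.mul_const (b := t)
          (ENNReal.tendsto_pow_atTop_nhds_top_iff.2 (ENNReal.one_lt_coe_iff.2 hK))
          (Or.inl ENNReal.top_ne_zero)
        rwa [ENNReal.top_mul ht0] at this
      exact ((h1.eventually_const_lt (hg x).lt_top).exists).imp fun _ h => h.le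
    obtain ⟨n, hn, hmin⟩ : ∃ n, g x ≤ K ^ (n + 1) * t ∧ K ^ n * t < g x := by
      classical
      have hf0 : Nat.find hex ≠ 0 := fun h0 => by
        have := Nat.find_spec hex
        rw [h0, pow_zero, one_mul] at this
        exact this.not_gt hgt
      obtain ⟨n, hn⟩ := Nat.exists_eq_succ_of_ne_zero hf0
      refine ⟨n, ?_, ?_⟩
      · have := Nat.find_spec hex
        rwa [hn] at this
      · exact not_le.1 (Nat.find_min hex (by omega))
    calc g x ^ p ≤ Q * a n := by
          rw [← hasucc]
          exact ENNReal.rpow_le_rpow hn hp.le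
      _ = (A n).indicator (fun _ => Q * a n) x := by
          rw [indicator_of_mem (hx n hmin)]
      _ ≤ ∑' n, (A n).indicator (fun _ => Q * a n) x :=
          ENNReal.le_tsum (f := fun n => (A n).indicator (fun _ => Q * a n) x) n
      _ ≤ _ := le_add_self
  calc ∫⁻ x, g x ^ p ∂μ ≤ ∫⁻ x, t ^ p + ∑' n, (A n).indicator (fun _ => Q * a n) x ∂μ :=
        lintegral_mono_ae hpt
    _ = X + Q * ∑' n, a n * μ (A n) := by
        rw [lintegral_add_left measurable_const, lintegral_const, lintegral_tsum
          fun n => (measurable_const.indicator (hA n)).aemeasurable, ← ENNReal.tsum_mul_left]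
        congr 2
        ext n
        rw [lintegral_indicator_const (hA n), mul_assoc]
    _ ≤ (X + Y) + Q * ((β⁻¹ * (1 + Q * ((q * ε ^ p)⁻¹ * Q)) : ℝ≥0) * (X + Y)) := by
        gcongr
        exact le_self_add
    _ = _ := by
        generalize β⁻¹ * (1 + Q * ((q * ε ^ p)⁻¹ * Q)) = c
        push_cast
        ring

end Summation

/-! ### From isoperimetry to the good-`λ` inequality -/

section Isoperimetric

variable {M : Type*} [MetricSpace M] [MeasurableSpace M] [BorelSpace M] {μ : Measure M}

/-- Under the complementary isoperimetric property, every open set of sufficiently small measure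
has a proportion of its mass near its complement. -/
lemma ComplementaryIsoperimetric.exists_layer [IsFiniteMeasure μ]
    (hIP : ComplementaryIsoperimetric μ) (hLD : LocallyDoubling μ) (hpos : BallsPos μ)
    {R : ℝ} (hR : 0 < R) : ∃ (κ : ℝ) (θ m : ℝ≥0), 0 < κ ∧ κ ≤ R ∧ θ ≠ 0 ∧ θ ≤ 1 ∧ m ≠ 0 ∧
      ∀ A : Set M, IsOpen A → μ A < m → θ * μ A ≤ μ (innerBoundaryLayer A κ) := by
  obtain ⟨c₀, r₀, κ₀, C, hr₀, hκ₀, hC, h⟩ := hIP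
  set κ := min κ₀ R
  have hκ : 0 < κ := lt_min hκ₀ hR
  set ρ := r₀ + 2 * κ
  have hρ : 0 < ρ := by positivity
  -- Near `B₀` isoperimetry says nothing. There doubling bounds the mass of `κ`-balls below by `m`,
  -- so a set of measure less than `m` contains none of them and all its points there lie in the
  -- layer.
  obtain ⟨m, hm0, hm⟩ : ∃ m : ℝ≥0, m ≠ 0 ∧ ∀ x ∈ ball c₀ ρ, (m : ℝ≥0∞) ≤ μ (ball x κ) := by
    obtain ⟨n, hn⟩ := pow_unbounded_of_one_lt (2 * ρ / κ) (one_lt_two)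
    rw [div_lt_iff₀ hκ] at hn
    obtain ⟨D, hD⟩ := hLD.exists_doublingUpTo (b := 2 ^ n * κ) (by positivity)
    have hle : ∀ x ∈ ball c₀ ρ, μ (ball c₀ ρ) ≤ (D : ℝ≥0∞) ^ n * μ (ball x κ) := fun x hx => by
      refine (measure_mono (ball_subset_ball' ?_)).trans (hD.pow x hκ n le_rfl)
      rw [mem_ball, dist_comm] at hx
      linarith
    have hDn : D ^ n ≠ 0 := fun h0 => by
      have := hle c₀ (mem_ball_self hρ)
      rw [← ENNReal.coe_pow, h0, ENNReal.coe_zero, zero_mul] at this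
      exact hpos c₀ ρ hρ (le_zero_iff.1 this)
    refine ⟨(μ (ball c₀ ρ)).toNNReal / D ^ n, div_ne_zero ?_ hDn, fun x hx => ?_⟩
    · exact fun h0 => (ENNReal.toNNReal_eq_zero_iff _).1 h0 |>.elim (hpos c₀ ρ hρ)
        (measure_ne_top _ _)
    · rw [ENNReal.coe_div hDn, ENNReal.coe_toNNReal (measure_ne_top _ _)]
      refine ENNReal.div_le_of_le_mul' ?_
      rw [ENNReal.coe_pow]
      exact hle x hx
  refine ⟨κ, min 1 (C * κ).toNNReal, m, hκ, min_le_right _ _, ?_, min_le_left _ _, hm0, ?_⟩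
  · exact (lt_min one_pos (Real.toNNReal_pos.2 (by positivity))).ne'
  intro A hA hAm
  have hnear : ∀ x ∈ A, x ∈ ball c₀ ρ → x ∈ innerBoundaryLayer A κ := fun x hxA hx => by
    have hns : ¬ ball x κ ⊆ A := fun hs =>
      ((hm x hx).trans (measure_mono hs)).not_gt hAm
    obtain ⟨y, hy, hyA⟩ := not_subset.1 hns
    refine ⟨hxA, (infEDist_le_edist_of_mem (y := y) hyA).trans ?_⟩
    rw [edist_dist, dist_comm]
    exact ENNReal.ofReal_le_ofReal (mem_ball.1 hy).le
  have hcl : closure (ball c₀ r₀) ⊆ closedBall c₀ r₀ := closure_ball_subset_closedBall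
  set U := A ∩ (closure (ball c₀ r₀))ᶜ with hU
  have hUo : IsOpen U := hA.inter isClosed_closure.isOpen_compl
  have h1 := h U hUo inter_subset_right κ hκ (min_le_left _ _)
  -- Cutting out the closed ball creates new boundary, but points within `κ` of it lie in `ball c₀
  -- ρ`, where `hnear` applies; this is why `ρ` exceeds `r₀` by `2 * κ`.
  have hUsub : innerBoundaryLayer U κ ⊆ innerBoundaryLayer A κ := by
    rintro x ⟨⟨hxA, hxc⟩, hx⟩
    rw [hU, compl_inter, compl_compl, infEDist_union, inf_le_iff] at hx
    rcases hx with hx | hx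
    · exact ⟨hxA, hx⟩
    · refine hnear x hxA ?_
      have h2 : infEDist x (closure (ball c₀ r₀)) < ENNReal.ofReal (2 * κ) :=
        hx.trans_lt ((ENNReal.ofReal_lt_ofReal_iff (by positivity)).2 (by linarith))
      obtain ⟨y, hy, hxy⟩ := infEDist_lt_iff.1 h2
      have h3 := edist_lt_ofReal.1 hxy
      have h4 := mem_closedBall.1 (hcl hy)
      have h5 := dist_triangle x y c₀
      rw [mem_ball]
      linarith
  have hVsub : A ∩ closure (ball c₀ r₀) ⊆ innerBoundaryLayer A κ := fun x hx => by
    refine hnear x hx.1 ?_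
    have := mem_closedBall.1 (hcl hx.2)
    rw [mem_ball]
    linarith
  have hVm : MeasurableSet (A ∩ closure (ball c₀ r₀)) :=
    hA.measurableSet.inter isClosed_closure.measurableSet
  have hdisj : Disjoint (A ∩ closure (ball c₀ r₀)) (innerBoundaryLayer U κ) :=
    disjoint_left.2 fun x hx hx' => hx'.1.2 hx.2
  calc ((min 1 (C * κ).toNNReal : ℝ≥0) : ℝ≥0∞) * μ A
      ≤ (min 1 (C * κ).toNNReal : ℝ≥0) * (μ (A ∩ closure (ball c₀ r₀)) + μ U) := by
        gcongr
        rw [hU, ← sdiff_eq, measure_inter_add_sdiff _ isClosed_closure.measurableSet]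
    _ ≤ 1 * μ (A ∩ closure (ball c₀ r₀)) + ENNReal.ofReal (C * κ) * μ U := by
        rw [mul_add]
        gcongr
        · exact_mod_cast min_le_left _ _
        · exact ENNReal.coe_le_coe.2 (min_le_right _ _)
    _ ≤ μ (A ∩ closure (ball c₀ r₀)) + μ (innerBoundaryLayer U κ) := by
        rw [one_mul]
        gcongr
    _ = μ (A ∩ closure (ball c₀ r₀) ∪ innerBoundaryLayer U κ) := (measure_union' hdisj hVm).symm
    _ ≤ _ := measure_mono (union_subset hVsub hUsub)

/-- The good-`λ` inequality relating the local maximal function and the local sharp function. -/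
lemma BallsPos.measure_maxSet_le [IsFiniteMeasure μ] (hpos : BallsPos μ) {D : ℝ≥0} {b b' R : ℝ}
    (hD : DoublingUpTo μ D b') (hR : 8 * R ≤ b) (hR' : 16 * R ≤ b') {f : M → ℂ}
    (hf : AEStronglyMeasurable f μ) {t : ℝ≥0∞} (ht0 : t ≠ 0) (ht : t ≠ ∞) {ε δ η θ : ℝ≥0}
    (hεD : (D ^ 3 + D ^ 4) * ε ≤ 2 * δ) (hε : ε ≤ δ) (hδ : δ ≠ 0) (hη : D ^ 8 * ε ≤ δ * η)
    (hηθ : 2 * η = θ) (hθ : θ ≤ 1) {κ : ℝ} (hκ0 : 0 ≤ κ) (hκ : 2 * κ ≤ R)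
    (hlayer : θ * μ (maxSet μ R (fun z => ‖f z‖ₑ) t) ≤
      μ (innerBoundaryLayer (maxSet μ R (fun z => ‖f z‖ₑ) t) κ)) :
    μ (maxSet μ R (fun z => ‖f z‖ₑ) ((1 + 2 * δ : ℝ≥0) * t)) ≤
      μ {x | ε * t < localSharp μ b f x} +
        (1 - η : ℝ≥0) * μ (maxSet μ R (fun z => ‖f z‖ₑ) t) := by
  have hgood := hpos.goodLambda_layer hD hR hR' hf ht0 ht hεD hε hκ0 hκ
  set A := maxSet μ R (fun z => ‖f z‖ₑ) t with hA
  set A' := maxSet μ R (fun z => ‖f z‖ₑ) ((1 + 2 * δ : ℝ≥0) * t) with hA'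
  set L := innerBoundaryLayer A κ with hL
  have hLm : MeasurableSet L :=
    (isOpen_maxSet R _ t).measurableSet.inter
      (measurableSet_le measurable_infEDist measurable_const)
  have hA'A : A' ⊆ A := maxSet_anti R _ (le_mul_of_one_le_left' (by
    rw [← ENNReal.coe_one, ENNReal.coe_le_coe]; exact le_self_add))
  have h1 : μ ({z ∈ A' | localSharp μ b f z ≤ ε * t} ∩ L) ≤ η * μ A := by
    have h2 : δ * μ ({z ∈ A' | localSharp μ b f z ≤ ε * t} ∩ L) ≤ δ * (η * μ A) := by
      rw [hA']
      push_cast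
      refine hgood.trans ?_
      rw [← mul_assoc]
      exact mul_le_mul_left (by exact_mod_cast hη) _
    exact (ENNReal.mul_le_mul_iff_right (by simpa using hδ) ENNReal.coe_ne_top).1 h2
  have h3 : μ (A \ L) + θ * μ A ≤ μ A := by
    calc μ (A \ L) + θ * μ A ≤ μ (A \ L) + μ L := by gcongr
      _ = μ A := by
        rw [add_comm, ← measure_inter_add_sdiff A hLm, inter_eq_right.2 fun x hx => hx.1]
  have h4 : A' ⊆ {x | ε * t < localSharp μ b f x} ∪
      (({z ∈ A' | localSharp μ b f z ≤ ε * t} ∩ L) ∪ A \ L) := by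
    intro x hx
    by_cases h5 : ε * t < localSharp μ b f x
    · exact Or.inl h5
    · by_cases h6 : x ∈ L
      · exact Or.inr (Or.inl ⟨⟨hx, not_lt.1 h5⟩, h6⟩)
      · exact Or.inr (Or.inr ⟨hA'A hx, h6⟩)
  have h5 : μ A' ≤ μ {x | ε * t < localSharp μ b f x} + (η * μ A + μ (A \ L)) :=
    (measure_mono h4).trans ((measure_union_le _ _).trans (by
      gcongr
      exact (measure_union_le _ _).trans (by gcongr)))
  refine h5.trans ?_
  gcongr
  have hη1 : η ≤ 1 := by
    refine le_trans ?_ hθ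
    rw [← hηθ, two_mul]
    exact le_self_add
  -- Since `θ = 2 * η`, half of the layer's share pays for the good-`λ` error. Adding `η * μ A` to
  -- both sides avoids subtraction in `ℝ≥0∞`.
  have h6 : η * μ A + (η * μ A + μ (A \ L)) ≤ η * μ A + (1 - η : ℝ≥0) * μ A := by
    calc η * μ A + (η * μ A + μ (A \ L)) = μ (A \ L) + θ * μ A := by
          rw [← hηθ]; push_cast; ring
      _ ≤ μ A := h3
      _ = η * μ A + (1 - η : ℝ≥0) * μ A := by
          rw [← add_mul, ← ENNReal.coe_add, add_tsub_cancel_of_le hη1, ENNReal.coe_one, one_mul]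
  exact (ENNReal.add_le_add_iff_left
    (ENNReal.mul_ne_top ENNReal.coe_ne_top (measure_ne_top _ _))).1 h6

end Isoperimetric

/-! ### Choice of constants and conclusion -/

lemma exists_rpow_mul_lt_one {p : ℝ} {α : ℝ≥0} (hα : α < 1) :
    ∃ δ : ℝ≥0, δ ≠ 0 ∧ (1 + 2 * δ) ^ p * α < 1 := by
  have hc : ContinuousAt (fun δ : ℝ≥0 => (1 + 2 * δ) ^ p * α) 0 := by
    refine ContinuousAt.mul ?_ continuousAt_const
    refine ContinuousAt.comp (g := fun x : ℝ≥0 => x ^ p) ?_ (by fun_prop)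
    exact NNReal.continuousAt_rpow_const (Or.inl (by simp))
  have h0 : (fun δ : ℝ≥0 => (1 + 2 * δ) ^ p * α) 0 < 1 := by simpa using hα
  have h1 : ∀ᶠ δ in 𝓝[>] (0 : ℝ≥0), (1 + 2 * δ) ^ p * α < 1 :=
    (hc.eventually_lt continuousAt_const h0).filter_mono nhdsWithin_le_nhds
  obtain ⟨δ, h2, h3⟩ := (h1.and self_mem_nhdsWithin).exists
  exact ⟨δ, pos_iff_ne_zero.1 h3, h2⟩

theorem theoremt {M : Type*} [MetricSpace M] [MeasurableSpace M] [BorelSpace M]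
    (μ : Measure M) [IsFiniteMeasure μ] (hμ : 0 < μ Set.univ)
    (hM : ¬ Bornology.IsBounded (Set.univ : Set M))
    (hLD : LocallyDoubling μ) (hIP : ComplementaryIsoperimetric μ)
    (b : ℝ) (hb : 0 < b) (p : ℝ) (hp : 1 < p) :
    ∃ C : ℝ, 0 < C ∧ ∀ f : M → ℂ, MemLp f (ENNReal.ofReal p) μ →
      ENNReal.ofReal C * eLpNorm f (ENNReal.ofReal p) μ
        ≤ eLpNorm f 1 μ + eLpNorm (localSharp μ b f) (ENNReal.ofReal p) μ := by
  have hp0 : 0 < p := one_pos.trans hp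
  have hpos := hLD.ballsPos hμ
  -- The good-`λ` argument uses oscillations over balls of radius up to `8 * R`, which must not
  -- exceed `b`.
  set R := b / 8 with hR
  have hR0 : 0 < R := by positivity
  obtain ⟨D, hD⟩ := hLD.exists_doublingUpTo (b := 16 * R) (by positivity)
  obtain ⟨κ, θ, m, hκ0, hκR, hθ0, hθ1, hm0, hlayer⟩ :=
    hIP.exists_layer hLD hpos (R := R / 2) (by positivity)
  set η := θ / 2 with hη
  have hη0 : η ≠ 0 := div_ne_zero hθ0 two_ne_zero
  have hηθ : 2 * η = θ := mul_div_cancel₀ θ two_ne_zero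
  obtain ⟨δ, hδ0, hδ⟩ := exists_rpow_mul_lt_one (p := p) (α := 1 - η)
    (tsub_lt_self one_pos (pos_iff_ne_zero.2 hη0))
  obtain ⟨ε, hε0, hεD, hε, hεη⟩ : ∃ ε : ℝ≥0, ε ≠ 0 ∧ (D ^ 3 + D ^ 4) * ε ≤ 2 * δ ∧ ε ≤ δ ∧
      D ^ 8 * ε ≤ δ * η := by
    have h1 : ∀ (E x : ℝ≥0), x ≠ 0 → ∀ᶠ ε in 𝓝[>] (0 : ℝ≥0), E * ε ≤ x := fun E x hx => by
      have hc : ContinuousAt (fun ε : ℝ≥0 => E * ε) 0 := by fun_prop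
      exact ((hc.eventually_lt continuousAt_const
        (by simpa using pos_iff_ne_zero.2 hx)).filter_mono nhdsWithin_le_nhds).mono
          fun _ h => h.le
    obtain ⟨ε, ⟨⟨h2, h3⟩, h4⟩, h5⟩ := ((((h1 (D ^ 3 + D ^ 4) (2 * δ) (by simpa using hδ0)).and
      (h1 1 δ hδ0)).and (h1 (D ^ 8) (δ * η) (mul_ne_zero hδ0 hη0))).and self_mem_nhdsWithin).exists
    exact ⟨ε, pos_iff_ne_zero.1 h5, h2, by simpa using h3, h4⟩
  obtain ⟨C, hC⟩ := exists_lintegral_rpow_le_of_goodLambda (M := M) hp0 (K := 1 + 2 * δ)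
    (lt_add_of_pos_right 1 (by positivity)) hδ hε0
  -- At `t = Λ * ‖f‖₁` the weak type bound gives measure below `m`; the `+ 1` makes this strict.
  set Λ : ℝ≥0 := (D ^ 3 + 1) / m with hΛ
  have hΛ0 : Λ ≠ 0 := div_ne_zero (by positivity) hm0
  -- the estimate for `p`-th powers
  have main : ∀ f : M → ℂ, MemLp f (ENNReal.ofReal p) μ → eLpNorm f 1 μ ≠ 0 →
      ∫⁻ x, ‖f x‖ₑ ^ p ∂μ ≤ C * ((Λ * eLpNorm f 1 μ) ^ p * μ univ +
        ∫⁻ x, localSharp μ b f x ^ p ∂μ) := by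
    intro f hf hf0
    have hfi : MemLp f 1 μ := hf.mono_exponent (by
      rw [← ENNReal.ofReal_one]; exact ENNReal.ofReal_le_ofReal hp.le)
    have hft : eLpNorm f 1 μ ≠ ∞ := hfi.2.ne
    set t := Λ * eLpNorm f 1 μ with htdef
    have ht0 : t ≠ 0 := mul_ne_zero (by simpa using hΛ0) hf0
    have ht : t ≠ ∞ := ENNReal.mul_ne_top ENNReal.coe_ne_top hft
    have hKt : ∀ n : ℕ, t ≤ ((1 + 2 * δ : ℝ≥0) : ℝ≥0∞) ^ n * t := fun n =>
      le_mul_of_one_le_left' (one_le_pow₀ (by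
        rw [← ENNReal.coe_one, ENNReal.coe_le_coe]; exact le_self_add))
    have hsmall : ∀ s, t ≤ s → μ (maxSet μ R (fun z => ‖f z‖ₑ) s) < m := fun s hs => by
      refine (measure_mono (maxSet_anti R _ hs)).trans_lt ?_
      by_contra! hle
      have h1 := hpos.mul_measure_maxSet_le hD (R := R) (by linarith) (fun z => ‖f z‖ₑ) t
      rw [← eLpNorm_one_eq_lintegral_enorm] at h1
      have h2 : ((D ^ 3 + 1 : ℝ≥0) : ℝ≥0∞) * eLpNorm f 1 μ ≤ (D : ℝ≥0∞) ^ 3 * eLpNorm f 1 μ := by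
        calc ((D ^ 3 + 1 : ℝ≥0) : ℝ≥0∞) * eLpNorm f 1 μ = t * m := by
              rw [htdef, mul_right_comm, ← ENNReal.coe_mul, hΛ, div_mul_cancel₀ _ hm0]
          _ ≤ _ := (by gcongr : t * m ≤ _).trans h1
      rw [ENNReal.mul_le_mul_iff_left hf0 hft, ← ENNReal.coe_pow, ENNReal.coe_le_coe] at h2
      exact (lt_add_one (D ^ 3)).not_ge h2
    refine hC μ _ _ (fun n => maxSet μ R (fun z => ‖f z‖ₑ) ((1 + 2 * δ : ℝ≥0) ^ n * t)) t
      (measurable_localSharp b f) (fun x => enorm_ne_top) ht0 ht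
      (fun n => (isOpen_maxSet R _ _).measurableSet) ?_ fun n => ?_
    · filter_upwards [hpos.ae_mem_maxSet hD (by positivity) hR0 (memLp_one_iff_integrable.1 hfi)]
        with x hx n hn using hx _ hn
    · simp only [pow_succ', mul_assoc]
      exact hpos.measure_maxSet_le hD (by linarith) le_rfl hf.1 ((pos_iff_ne_zero.2 ht0).trans_le
        (hKt n)).ne' (ENNReal.mul_ne_top (by finiteness) ht) hεD hε hδ0 hεη hηθ hθ1
        hκ0.le (by linarith) (hlayer _ (isOpen_maxSet R _ _) (hsmall _ (hKt n)))
  -- passage to norms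
  set G : ℝ≥0 := C * (Λ ^ p * (μ univ).toNNReal + 1) + 1 with hG
  have hG0 : G ≠ 0 := by positivity
  have hGp : G ^ (1 / p) ≠ 0 := by simp [NNReal.rpow_eq_zero_iff, hG0]
  have hpne : ENNReal.ofReal p ≠ 0 := by simpa using hp0
  refine ⟨((G ^ (1 / p))⁻¹ : ℝ≥0), NNReal.coe_pos.2 (pos_iff_ne_zero.2 (inv_ne_zero hGp)),
    fun f hf => ?_⟩
  -- The base level `t` would vanish here, so this case is separate.
  rcases eq_or_ne (eLpNorm f 1 μ) 0 with hf0 | hf0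
  · have h1 : eLpNorm f (ENNReal.ofReal p) μ = 0 := by
      rw [eLpNorm_eq_zero_iff hf.1 one_ne_zero] at hf0
      exact (eLpNorm_eq_zero_iff hf.1 hpne).2 hf0
    simp [h1]
  set N := eLpNorm f 1 μ
  set S := eLpNorm (localSharp μ b f) (ENNReal.ofReal p) μ with hS
  have hSp : ∫⁻ x, localSharp μ b f x ^ p ∂μ = S ^ p := by
    rw [hS, eLpNorm_eq_lintegral_rpow_enorm_toReal hpne ENNReal.ofReal_ne_top,
      ENNReal.toReal_ofReal hp0.le, ← ENNReal.rpow_mul, one_div_mul_cancel hp0.ne',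
      ENNReal.rpow_one]
    simp
  have h1 : ∫⁻ x, ‖f x‖ₑ ^ p ∂μ ≤ G * (N + S) ^ p := by
    calc ∫⁻ x, ‖f x‖ₑ ^ p ∂μ ≤ C * ((Λ * N) ^ p * μ univ + S ^ p) := by
          rw [← hSp]; exact main f hf hf0
      _ ≤ C * ((Λ * (N + S)) ^ p * μ univ + (N + S) ^ p) := by
          gcongr
          · exact le_self_add
          · exact le_add_self
      _ = (C * (Λ ^ p * (μ univ).toNNReal + 1) : ℝ≥0) * (N + S) ^ p := by
          rw [ENNReal.mul_rpow_of_nonneg _ _ hp0.le]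
          push_cast
          rw [ENNReal.coe_rpow_of_nonneg _ hp0.le, ENNReal.coe_toNNReal (measure_ne_top _ _)]
          ring
      _ ≤ G * (N + S) ^ p := by
          gcongr
          exact le_self_add
  have h2 : eLpNorm f (ENNReal.ofReal p) μ ≤ (G ^ (1 / p) : ℝ≥0) * (N + S) := by
    rw [eLpNorm_eq_lintegral_rpow_enorm_toReal hpne ENNReal.ofReal_ne_top,
      ENNReal.toReal_ofReal hp0.le]
    calc (∫⁻ x, ‖f x‖ₑ ^ p ∂μ) ^ (1 / p) ≤ (G * (N + S) ^ p) ^ (1 / p) := by gcongr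
      _ = _ := by
        rw [ENNReal.mul_rpow_of_nonneg _ _ (by positivity), ← ENNReal.rpow_mul,
          mul_one_div_cancel hp0.ne', ENNReal.rpow_one,
          ENNReal.coe_rpow_of_nonneg _ (by positivity)]
  rw [ENNReal.ofReal_coe_nnreal, ENNReal.coe_inv hGp, mul_comm, ← div_eq_mul_inv]
  exact ENNReal.div_le_of_le_mul' h2
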